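/- Let $r\ge 1$, $\mathbf m=(m_1,\dots,m_r)$ with integers $m_j\ge1$, $m=m_1+\cdots+m_r$, $\mathbf f=(f_1,\dots,f_r)\in\mathbb C^r$ with no $f_j$ in $\{0,-1,-2,\dots\}$, and $a,b\in\mathbb C$. Write $(z)_n=z(z+1)\cdots(z+n-1)$, $(\mathbf f)_{\mathbf m}=\prod_{j}(f_j)_{m_j}$, $(\mathbf f-b)_{\mathbf m}=\prod_{j}(f_j-b)_{m_j}$, $\mathbf f+\mathbf m=(f_1+m_1,\dots,f_r+m_r)$, and $$C_{k,r}=\frac{1}{(\mathbf f)_{\mathbf m}}\sum_{i=k}^{m}\sigma_i\,S(i,k),\qquad \prod_{j=1}^{r}(f_j+x)_{m_j}=\sum_{i=0}^{m}\sigma_i x^i,$$ where $S(i,k)$ are the Stirling numbers of the second kind. Let ${}_pF_q$ be the generalized hypergeometric function; for $p=q+1$ it is understood on $\mathbb C\setminus[1,\infty)$ as the analytic continuation of its power series (this continuation exists for the functions below), and powers $(1-x)^a$ are principal. Suppose that $b+1\notin\{0,-1,-2,\dots\}$ and that $f_j-b\notin\{1-m_j,2-m_j,\dots,0\}$ for $1\le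 j\le r$. Then $$(1-x)^{a}\,{}_{r+2}F_{r+1}\!\left(\begin{matrix}a,b,\mathbf f+\mathbf m\\ b+1,\mathbf f\end{matrix}\,\middle|\,x\right)=\sum_{j=0}^{m-1}\frac{(a)_j}{(b+1)_j}\left(\frac{x}{x-1}\right)^{j}\sum_{k=0}^{j}(-1)^k(b)_kC_{k,r}+\frac{x^m(a)_m(\mathbf f-b)_{\mathbf m}}{(x-1)^m(b+1)_m(\mathbf f)_{\mathbf m}}\,{}_2F_1\!\left(\begin{matrix}1,a+m\\ b+m+1\end{matrix}\,\middle|\,\frac{x}{x-1}\right)$$ for all $x\in\mathbb C\setminus[1,\infty)$ (for which also $x/(x-1)\in\mathbb C\setminus[1,\infty)$), and $$e^{-x}\,{}_{r+1}F_{r+1}\!\left(\begin{matrix}b,\mathbf f+\mathbf m\\ b+1,\mathbf f\end{matrix}\,\middle|\,x\right)=\sum_{j=0}^{m-1}\frac{(-x)^j}{(b+1)_j}\sum_{k=0}^{j}(-1)^k(b)_kC_{k,r}+\frac{(-x)^m(\mathbf f-b)_{\mathbf m}}{(b+1)_m(\mathbf f)_{\mathbf m}}\,{}_1F_1\!\left(\begin{matrix}1\\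 b+m+1\end{matrix}\,\middle|\,-x\right)$$ for all $x\in\mathbb C$, where all the series converge. -/

import Mathlib

/-- The rising factorial (Pochhammer symbol) `(z)_n = z (z + 1) ⋯ (z + n - 1)`, `(z)_0 = 1`. -/
noncomputable def poch (z : ℂ) (n : ℕ) : ℂ := (ascPochhammer ℂ n).eval z

/-- The `n`-th term `(a₁)_n ⋯ (a_p)_n / ((b₁)_n ⋯ (b_q)_n n!) xⁿ` of the generalized
hypergeometric series. -/
noncomputable def pFqTerm {p q : ℕ} (a : Fin p → ℂ) (b : Fin q → ℂ) (x : ℂ) (n : ℕ) : ℂ :=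
  (∏ i, poch (a i) n) / ((∏ i, poch (b i) n) * (n.factorial : ℂ)) * x ^ n

/-- The sum of the generalized hypergeometric series. For `p ≤ q` it converges on all of `ℂ`
and is the entire function `pFq(a; b; x)`. -/
noncomputable def pFqSeries {p q : ℕ} (a : Fin p → ℂ) (b : Fin q → ℂ) (x : ℂ) : ℂ :=
  ∑' n : ℕ, pFqTerm a b x n

/-- The cut plane `ℂ \ [1, ∞)`. -/
def cutPlane : Set ℂ := ((fun t : ℝ => (t : ℂ)) '' Set.Ici 1)ᶜ

/-- `F` is the analytic continuation to `ℂ \ [1, ∞)` of the hypergeometric series: it is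
holomorphic there, and in the open unit disc the series converges to it. -/
def IsHypergeometricContinuation {p q : ℕ} (a : Fin p → ℂ) (b : Fin q → ℂ) (F : ℂ → ℂ) : Prop :=
  DifferentiableOn ℂ F cutPlane ∧ ∀ x ∈ Metric.ball (0 : ℂ) 1, HasSum (pFqTerm a b x) (F x)

open Classical in
/-- The generalized hypergeometric function on `ℂ \ [1, ∞)` (used for `p = q + 1`): the analytic
continuation of the hypergeometric series. Only its values on `ℂ \ [1, ∞)` have a meaning, where
they do not depend on the choice made (`IsHypergeometricContinuation.eqOn`). -/
noncomputable def pFqCut {p q : ℕ} (a : Fin p → ℂ) (b : Fin q → ℂ) : ℂ → ℂ :=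
  if h : ∃ F : ℂ → ℂ, IsHypergeometricContinuation a b F then h.choose else 0

theorem cutPlane_eq : cutPlane = {x : ℂ | x.re < 1 ∨ x.im ≠ 0} := by
  ext x
  simp only [cutPlane, Set.mem_compl_iff, Set.mem_image, Set.mem_Ici, Set.mem_ofPred_eq]
  constructor
  · intro h
    by_contra! hc
    exact h ⟨x.re, hc.1, Complex.ext (by simp) (by simp [hc.2])⟩
  · rintro h ⟨t, ht, rfl⟩
    simp at h
    linarith

/-- The analytic continuation is unique on `ℂ \ [1, ∞)`. -/
theorem IsHypergeometricContinuation.eqOn {p q : ℕ} {a : Fin p → ℂ} {b : Fin q → ℂ}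
    {F G : ℂ → ℂ} (hF : IsHypergeometricContinuation a b F)
    (hG : IsHypergeometricContinuation a b G) : Set.EqOn F G cutPlane := by
  have hopen : IsOpen cutPlane := by
    rw [cutPlane_eq]
    exact (isOpen_lt Complex.continuous_re continuous_const).union
      (isOpen_ne_fun Complex.continuous_im continuous_const)
  have h0 : (0 : ℂ) ∈ cutPlane := by simp [cutPlane_eq]
  have hstar : StarConvex ℝ (0 : ℂ) cutPlane := by
    rw [starConvex_zero_iff, cutPlane_eq]
    intro x hx t ht0 ht1
    rcases eq_or_lt_of_le ht0 with rfl | ht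
    · simp
    · rcases hx with hx | hx
      · left
        simp only [Complex.smul_re, smul_eq_mul]
        nlinarith
      · right
        simp [hx, ht.ne']
  refine (hF.1.analyticOnNhd hopen).eqOn_of_preconnected_of_eventuallyEq
    (hG.1.analyticOnNhd hopen) (StarConvex.isPathConnected hstar h0).isConnected.isPreconnected h0 ?_
  filter_upwards [Metric.ball_mem_nhds (0 : ℂ) one_pos] with x hx
  exact (hF.2 x hx).unique (hG.2 x hx)

/-- `(f)_m = (f₁)_{m₁} ⋯ (f_r)_{m_r}` for vectors `f` and `m`. -/
noncomputable def vecPoch {r : ℕ} (f : Fin r → ℂ) (m : Fin r → ℕ) : ℂ := ∏ j, poch (f j) (m j)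

/-- The number `σ_i`: the coefficient of `x^i` in `(f₁ + x)_{m₁} ⋯ (f_r + x)_{m_r}`. -/
noncomputable def sigmaCoeff {r : ℕ} (f : Fin r → ℂ) (m : Fin r → ℕ) (i : ℕ) : ℂ :=
  (∏ j, (ascPochhammer ℂ (m j)).comp (Polynomial.C (f j) + Polynomial.X)).coeff i

/-- The number `C_{k,r} = (1 / (f)_m) ∑_{i=k}^{m₁+⋯+m_r} σ_i S(i, k)`, with `S(i, k)` the Stirling
numbers of the second kind. -/
noncomputable def Ccoeff {r : ℕ} (f : Fin r → ℂ) (m : Fin r → ℕ) (k : ℕ) : ℂ :=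
  1 / vecPoch f m *
    ∑ i ∈ Finset.Icc k (∑ j, m j), sigmaCoeff f m i * (Nat.stirlingSecond i k : ℂ)

/-! The quotient (f+m)_n/(f)_n equals (f+n)_m/(f)_m, a polynomial P(n) whose coefficients in the
falling-factorial basis are the C_k (`prod_poch_shift_div`). So the left-hand series is ∑ (a)_n/n!
c_n xⁿ with c_n = (b)_n/(b+1)_n P(n).

Summing an absolutely convergent double series in two ways (Pfaff's transformation,
`hasSum_euler_transform`) turns (1-x)^a times this series into a series in y = x/(x-1) with
coefficients (a)_j/j! ∑ (-1)ⁿ C(j,n) c_n. Chu–Vandermonde, applied to each falling factorial,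
evaluates the inner sum as j!/(b+1)_j ∑_{k≤j} (-1)^k (b)_k C_k (`sum_choose_mul_stirlingPoly`).
Since (-1)^k (b)_k is the k-th falling factorial of -b, for j ≥ m the sum over k is P(-b) =
(f-b)_m/(f)_m, independent of j, and the tail is a multiple of ₂F₁(1, a+m; b+m+1; y).

This proves the first identity near 0. Its right-hand side, divided by (1-x)^a, is holomorphic on
the cut plane, hence is the continuation of the left-hand series; the continuation of the ₂F₁ comes
from Euler's integral and a contiguous relation. In the confluent case a Cauchy product with e^{-x}
replaces Pfaff's transformation and no continuation is needed. -/

/-! ### Pochhammer symbols -/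

theorem poch_zero (z : ℂ) : poch z 0 = 1 := by simp [poch]

theorem poch_succ (z : ℂ) (n : ℕ) : poch z (n + 1) = poch z n * (z + n) :=
  ascPochhammer_succ_eval n z

theorem poch_add (z : ℂ) (m n : ℕ) : poch z (m + n) = poch z m * poch (z + m) n := by
  simp [poch, ← ascPochhammer_mul]

theorem poch_succ_left (z : ℂ) (n : ℕ) : poch z (n + 1) = z * poch (z + 1) n := by
  rw [add_comm, poch_add, poch_succ, poch_zero]
  simp

theorem poch_one (n : ℕ) : poch 1 n = n.factorial := by
  induction n with
  | zero => simp [poch_zero]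
  | succ n ih => rw [poch_succ, ih, Nat.factorial_succ]; push_cast; ring

theorem poch_ne_zero {z : ℂ} {n : ℕ} (h : ∀ i < n, z ≠ -(i : ℂ)) : poch z n ≠ 0 := by
  induction n with
  | zero => simp [poch_zero]
  | succ n ih =>
    rw [poch_succ]
    refine mul_ne_zero (ih fun i hi => h i (hi.trans n.lt_succ_self)) fun h0 => ?_
    exact h n n.lt_succ_self (eq_neg_of_add_eq_zero_left h0)

theorem poch_mul_add (b : ℂ) (n : ℕ) : poch b n * (b + n) = b * poch (b + 1) n := by
  rw [← poch_succ, poch_succ_left]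

/-- Lets a binomial series with parameter ‖a‖ majorize the double series of Pfaff's transformation.
-/
theorem norm_poch_le (z : ℂ) (n : ℕ) : ‖poch z n‖ ≤ ‖poch (‖z‖ : ℂ) n‖ := by
  induction n with
  | zero => simp [poch_zero]
  | succ n ih =>
    rw [poch_succ, poch_succ, norm_mul, norm_mul]
    gcongr
    refine (norm_add_le _ _).trans (le_of_eq ?_)
    rw [← Complex.ofReal_natCast, ← Complex.ofReal_add, Complex.norm_real, Complex.norm_real,
      Real.norm_of_nonneg (by positivity), Real.norm_of_nonneg (by positivity)]

theorem add_one_ne_neg_natCast {z : ℂ} (h : ∀ n : ℕ, z ≠ -(n : ℂ)) (k : ℕ) :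
    ∀ n : ℕ, z + k ≠ -(n : ℂ) := by
  intro n hn
  apply h (k + n)
  push_cast
  linear_combination hn

/-! ### Falling factorials and Stirling numbers -/

/-- The falling factorial `z (z - 1) ⋯ (z - n + 1)`. -/
noncomputable def fall (z : ℂ) (n : ℕ) : ℂ := (descPochhammer ℂ n).eval z

theorem fall_succ (z : ℂ) (n : ℕ) : fall z (n + 1) = fall z n * (z - n) :=
  descPochhammer_succ_eval n z

theorem fall_natCast (n k : ℕ) : fall n k = (n.descFactorial k : ℂ) :=
  descPochhammer_eval_eq_descFactorial ℂ n k

theorem fall_neg (b : ℂ) (k : ℕ) : fall (-b) k = (-1) ^ k * poch b k := by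
  have := ascPochhammer_eval_neg_eq_descPochhammer ℂ (-b) k
  rw [neg_neg] at this
  rw [poch, this, ← mul_assoc, ← mul_pow]
  simp [fall]

theorem pow_eq_sum_stirlingSecond_mul_fall (z : ℂ) (i : ℕ) {N : ℕ} (hN : i ≤ N) :
    z ^ i = ∑ k ∈ Finset.range (N + 1), (Nat.stirlingSecond i k : ℂ) * fall z k := by
  induction i generalizing N with
  | zero =>
    rw [Finset.sum_range_succ']
    simp [fall]
  | succ i ih =>
    obtain ⟨N, rfl⟩ : ∃ K, N = K + 1 := ⟨N - 1, by omega⟩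
    rw [Finset.sum_range_succ', Nat.stirlingSecond_succ_zero, pow_succ,
      ih (show i ≤ N by omega), Finset.sum_mul]
    have h1 : ∀ k ∈ Finset.range (N + 1), (Nat.stirlingSecond (i + 1) (k + 1) : ℂ) * fall z (k + 1)
        = ((k + 1 : ℕ) * (Nat.stirlingSecond i (k + 1) : ℂ) * fall z (k + 1)) +
          (Nat.stirlingSecond i k : ℂ) * fall z k * (z - k) := by
      intro k _
      rw [Nat.stirlingSecond_succ_succ, fall_succ]
      push_cast
      ring
    rw [Finset.sum_congr rfl h1, Finset.sum_add_distrib]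
    -- Undoes the index shift: the k = 0 term has the factor 0, and the top term vanishes because
    -- S(i, N+1) = 0 for i ≤ N.
    have h2 := Finset.sum_range_succ' (fun k : ℕ => (k : ℂ) * (Nat.stirlingSecond i k : ℂ) *
      fall z k) (N + 1)
    rw [Finset.sum_range_succ, Nat.stirlingSecond_eq_zero_of_lt (show i < N + 1 by omega)] at h2
    simp only [Nat.cast_zero, mul_zero, zero_mul, add_zero] at h2 ⊢
    rw [← h2, ← Finset.sum_add_distrib]
    refine Finset.sum_congr rfl fun k _ => ?_
    ring

/-! ### The parameter shift as a polynomial in the summation index -/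

section

variable {r : ℕ} (f : Fin r → ℂ) (m : Fin r → ℕ)

/-- The polynomial function `x ↦ ∑ₖ C_k x (x - 1) ⋯ (x - k + 1)`. -/
noncomputable def stirlingPoly (x : ℂ) : ℂ :=
  ∑ k ∈ Finset.range (∑ j, m j + 1), Ccoeff f m k * fall x k

theorem vecPoch_ne_zero {f : Fin r → ℂ} (hf : ∀ j, ∀ n : ℕ, f j ≠ -(n : ℂ)) (m : Fin r → ℕ) :
    vecPoch f m ≠ 0 :=
  Finset.prod_ne_zero_iff.2 fun j _ => poch_ne_zero fun i _ => hf j i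

theorem vecPoch_add_eq_stirlingPoly (h0 : vecPoch f m ≠ 0) (x : ℂ) :
    vecPoch (fun j => f j + x) m = vecPoch f m * stirlingPoly f m x := by
  set p : Polynomial ℂ :=
    ∏ j, (ascPochhammer ℂ (m j)).comp (Polynomial.C (f j) + Polynomial.X) with hp
  have h1 : vecPoch (fun j => f j + x) m = p.eval x := by
    simp [hp, vecPoch, poch, Polynomial.eval_prod]
  have hdeg : p.natDegree < ∑ j, m j + 1 := by
    refine Nat.lt_succ_of_le ((Polynomial.natDegree_prod_le _ _).trans ?_)
    refine Finset.sum_le_sum fun j _ => ?_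
    refine Polynomial.natDegree_comp_le.trans ?_
    rw [ascPochhammer_natDegree]
    refine (Nat.mul_le_mul_left _ (Polynomial.natDegree_add_le_of_degree_le
      (n := 1) (by simp) (by simp))).trans (by simp)
  rw [h1, Polynomial.eval_eq_sum_range' hdeg, stirlingPoly, Finset.mul_sum]
  have h2 : ∀ i ∈ Finset.range (∑ j, m j + 1), p.coeff i * x ^ i =
      ∑ k ∈ Finset.range (∑ j, m j + 1),
        p.coeff i * ((Nat.stirlingSecond i k : ℂ) * fall x k) := by
    intro i hi
    rw [← Finset.mul_sum, ← pow_eq_sum_stirlingSecond_mul_fall x i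
      (Nat.lt_succ_iff.1 (Finset.mem_range.1 hi))]
  rw [Finset.sum_congr rfl h2, Finset.sum_comm]
  refine Finset.sum_congr rfl fun k _ => ?_
  rw [Ccoeff, ← mul_assoc, ← mul_assoc, mul_one_div, div_self h0, one_mul, Finset.sum_mul]
  symm
  refine Finset.sum_subset_zero_on_sdiff (fun i hi => ?_) (fun i hi => ?_) (fun i _ => ?_)
  · simp only [Finset.mem_Icc, Finset.mem_range] at hi ⊢
    omega
  · simp only [Finset.mem_sdiff, Finset.mem_Icc, Finset.mem_range] at hi
    rw [Nat.stirlingSecond_eq_zero_of_lt (by omega)]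
    simp
  · rw [sigmaCoeff, mul_assoc]

theorem stirlingPoly_eq_div (h0 : vecPoch f m ≠ 0) (x : ℂ) :
    stirlingPoly f m x = vecPoch (fun j => f j + x) m / vecPoch f m := by
  rw [vecPoch_add_eq_stirlingPoly f m h0, mul_div_cancel_left₀ _ h0]

/-- Both (f)_m (f+m)_n and (f)_n (f+n)_m equal (f)_{m+n}. -/
theorem prod_poch_shift_div (hf : ∀ j, ∀ n : ℕ, f j ≠ -(n : ℂ)) (n : ℕ) :
    (∏ j, poch (f j + m j) n) / ∏ j, poch (f j) n = stirlingPoly f m n := by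
  have h0 : ∏ j, poch (f j) n ≠ 0 :=
    Finset.prod_ne_zero_iff.2 fun j _ => poch_ne_zero fun i _ => hf j i
  rw [stirlingPoly_eq_div f m (vecPoch_ne_zero hf m), div_eq_div_iff h0 (vecPoch_ne_zero hf m),
    vecPoch, vecPoch, ← Finset.prod_mul_distrib, ← Finset.prod_mul_distrib]
  refine Finset.prod_congr rfl fun j _ => ?_
  rw [mul_comm, ← poch_add, add_comm (m j), poch_add, mul_comm]

/-- A crude geometric bound suffices: Pfaff's transformation is only needed near 0, and the
confluent series has factorials to spare. -/
theorem exists_norm_stirlingPoly_le : ∃ K : ℝ, ∀ n : ℕ, ‖stirlingPoly f m n‖ ≤ K * 2 ^ n := by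
  refine ⟨∑ k ∈ Finset.range (∑ j, m j + 1), ‖Ccoeff f m k‖ * k.factorial, fun n => ?_⟩
  rw [Finset.sum_mul]
  refine (norm_sum_le _ _).trans (Finset.sum_le_sum fun k _ => ?_)
  rw [norm_mul, mul_assoc]
  gcongr
  rw [fall_natCast, Complex.norm_natCast, Nat.descFactorial_eq_factorial_mul_choose]
  push_cast
  gcongr
  exact_mod_cast Nat.choose_le_two_pow n k

end

/-! ### Binomial transform of the coefficients -/

/-- Chu–Vandermonde for ₂F₁(-N, b; b+1; 1). Pascal's rule reduces N+1 to N at the parameters b and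
b+1. -/
theorem sum_choose_mul_poch_div {b : ℂ} (hb : ∀ n : ℕ, b + 1 ≠ -(n : ℂ)) (N : ℕ) :
    ∑ n ∈ Finset.range (N + 1), (-1) ^ n * (N.choose n : ℂ) * (poch b n / poch (b + 1) n) =
      N.factorial / poch (b + 1) N := by
  induction N generalizing b with
  | zero => simp [poch_zero]
  | succ N ih =>
    have hb' : ∀ n : ℕ, b + 1 + 1 ≠ -(n : ℂ) := by
      simpa using add_one_ne_neg_natCast hb 1
    have h1 : ∀ n ∈ Finset.range (N + 1), (-1 : ℂ) ^ (n + 1) * ((N + 1).choose (n + 1) : ℂ) *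
        (poch b (n + 1) / poch (b + 1) (n + 1)) =
        (-1) ^ (n + 1) * (N.choose (n + 1) : ℂ) * (poch b (n + 1) / poch (b + 1) (n + 1)) -
        b / (b + 1) * ((-1) ^ n * (N.choose n : ℂ) *
          (poch (b + 1) n / poch (b + 1 + 1) n)) := by
      intro n _
      rw [Nat.choose_succ_succ, poch_succ_left b, poch_succ_left (b + 1), mul_div_mul_comm]
      push_cast
      ring
    have hb0 : b + 1 ≠ 0 := by simpa using hb 0
    have hbN : b + 1 + N ≠ 0 := fun h => hb N (eq_neg_of_add_eq_zero_left h)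
    have hp : poch (b + 1) N ≠ 0 := poch_ne_zero fun i _ => hb i
    have hp' : poch (b + 1 + 1) N ≠ 0 := poch_ne_zero fun i _ => hb' i
    rw [Finset.sum_range_succ', Finset.sum_congr rfl h1, Finset.sum_sub_distrib, ← Finset.mul_sum,
      ih hb', sub_add_eq_add_sub]
    have h2 := Finset.sum_range_succ' (fun n : ℕ => (-1 : ℂ) ^ n * (N.choose n : ℂ) *
      (poch b n / poch (b + 1) n)) (N + 1)
    rw [Finset.sum_range_succ, Nat.choose_succ_self, ih hb] at h2
    simp only [Nat.choose_zero_right] at h2 ⊢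
    rw [← h2, poch_succ (b + 1) N]
    have h3 := poch_mul_add (b + 1) N
    have h4 : poch (b + 1 + 1) N = poch (b + 1) N * (b + 1 + N) / (b + 1) := by
      rw [h3]; field_simp
    rw [h4, Nat.factorial_succ]
    push_cast
    field_simp
    ring

/-- The absorption (n+1) C(j+1, n+1) = (j+1) C(j, n) removes one factor of the falling factorial,
lowering k and j by one and raising b by one. -/
theorem sum_choose_mul_fall_mul_poch_div {b : ℂ} (hb : ∀ n : ℕ, b + 1 ≠ -(n : ℂ)) (k j : ℕ) :
    ∑ n ∈ Finset.range (j + 1),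
        (-1) ^ n * (j.choose n : ℂ) * (poch b n / poch (b + 1) n * fall n k) =
      if k ≤ j then (-1) ^ k * poch b k * (j.factorial / poch (b + 1) j) else 0 := by
  induction k generalizing b j with
  | zero => simpa [fall, poch_zero] using sum_choose_mul_poch_div hb j
  | succ k ih =>
    cases j with
    | zero => simp [fall_natCast]
    | succ j =>
      have hb' : ∀ n : ℕ, b + 1 + 1 ≠ -(n : ℂ) := by
        simpa using add_one_ne_neg_natCast hb 1
      have hb0 : b + 1 ≠ 0 := by simpa using hb 0
      rw [Finset.sum_range_succ']
      have h1 : ∀ n ∈ Finset.range (j + 1), (-1 : ℂ) ^ (n + 1) * ((j + 1).choose (n + 1) : ℂ) *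
          (poch b (n + 1) / poch (b + 1) (n + 1) * fall (n + 1 : ℕ) (k + 1)) =
          -((j + 1) * (b / (b + 1))) * ((-1) ^ n * (j.choose n : ℂ) *
          (poch (b + 1) n / poch (b + 1 + 1) n * fall n k)) := by
        intro n _
        have h2 : ((j + 1).choose (n + 1) : ℂ) * (n + 1) = (j + 1) * j.choose n := by
          exact_mod_cast (Nat.add_one_mul_choose_eq j n).symm
        rw [fall_natCast, fall_natCast, Nat.succ_descFactorial_succ, poch_succ_left b,
          poch_succ_left (b + 1), mul_div_mul_comm]
        push_cast
        linear_combination (-1 : ℂ) ^ (n + 1) * (b / (b + 1)) *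
          (poch (b + 1) n / poch (b + 1 + 1) n) * (n.descFactorial k) * h2
      rw [Finset.sum_congr rfl h1, ← Finset.mul_sum, ih hb', fall_natCast]
      simp only [Nat.zero_descFactorial_succ, Nat.cast_zero, mul_zero, add_zero,
        Nat.add_le_add_iff_right]
      split_ifs with h
      · rw [poch_succ_left b, poch_succ_left (b + 1), Nat.factorial_succ]
        push_cast
        field_simp
        ring
      · simp

section

variable {r : ℕ} (f : Fin r → ℂ) (m : Fin r → ℕ)

theorem sum_choose_mul_stirlingPoly {b : ℂ} (hb : ∀ n : ℕ, b + 1 ≠ -(n : ℂ)) (j : ℕ) :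
    ∑ n ∈ Finset.range (j + 1),
        (-1) ^ n * (j.choose n : ℂ) * (poch b n / poch (b + 1) n * stirlingPoly f m n) =
      j.factorial / poch (b + 1) j *
        ∑ k ∈ Finset.range (j + 1), (-1) ^ k * poch b k * Ccoeff f m k := by
  have h1 : ∀ n ∈ Finset.range (j + 1), (-1 : ℂ) ^ n * (j.choose n : ℂ) *
      (poch b n / poch (b + 1) n * stirlingPoly f m n) =
      ∑ k ∈ Finset.range (∑ j, m j + 1), Ccoeff f m k * ((-1) ^ n * (j.choose n : ℂ) *
        (poch b n / poch (b + 1) n * fall n k)) := by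
    intro n _
    rw [stirlingPoly, Finset.mul_sum, Finset.mul_sum]
    exact Finset.sum_congr rfl fun k _ => by ring
  rw [Finset.sum_congr rfl h1, Finset.sum_comm]
  simp_rw [← Finset.mul_sum, sum_choose_mul_fall_mul_poch_div hb]
  rw [Finset.mul_sum]
  have hC : ∀ k, ∑ j, m j < k → Ccoeff f m k = 0 := by
    intro k hk
    rw [Ccoeff, Finset.Icc_eq_empty (by omega)]
    simp
  -- One sum stops at k = m, the other at k = j; past the minimum the binomial sum or C_k vanishes.
  trans ∑ k ∈ Finset.range (min (∑ j, m j) j + 1),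
      j.factorial / poch (b + 1) j * ((-1) ^ k * poch b k * Ccoeff f m k)
  · symm
    refine Finset.sum_subset_zero_on_sdiff (fun i hi => ?_) (fun i hi => ?_) (fun i hi => ?_)
    · simp only [Finset.mem_range] at hi ⊢
      omega
    · simp only [Finset.mem_sdiff, Finset.mem_range] at hi
      rw [if_neg (by omega), mul_zero]
    · simp only [Finset.mem_range] at hi
      rw [if_pos (by omega)]
      ring
  · refine Finset.sum_subset_zero_on_sdiff (fun i hi => ?_) (fun i hi => ?_) (fun i hi => rfl)
    · simp only [Finset.mem_range] at hi ⊢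
      omega
    · simp only [Finset.mem_sdiff, Finset.mem_range] at hi
      rw [hC i (by omega)]
      simp

/-- The untruncated sum is the polynomial of the shift evaluated at -b. -/
theorem sum_neg_one_pow_mul_Ccoeff (b : ℂ) {j : ℕ} (hj : ∑ j, m j ≤ j) (h0 : vecPoch f m ≠ 0) :
    ∑ k ∈ Finset.range (j + 1), (-1) ^ k * poch b k * Ccoeff f m k =
      vecPoch (fun j => f j - b) m / vecPoch f m := by
  simp_rw [sub_eq_add_neg]
  rw [← stirlingPoly_eq_div f m h0, stirlingPoly]
  symm
  refine Finset.sum_subset_zero_on_sdiff (fun i hi => ?_) (fun i hi => ?_) (fun i hi => ?_)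
  · simp only [Finset.mem_range] at hi ⊢
    omega
  · simp only [Finset.mem_sdiff, Finset.mem_range] at hi
    rw [Ccoeff, Finset.Icc_eq_empty (by omega)]
    simp
  · rw [fall_neg]
    ring

end

/-! ### Pfaff's transformation and its exponential analogue -/

theorem hasSum_binomial (a : ℂ) {y : ℂ} (hy : ‖y‖ < 1) :
    HasSum (fun n : ℕ => poch a n / n.factorial * y ^ n) ((1 - y) ^ (-a)) := by
  have h := (Complex.one_div_one_sub_cpow_hasFPowerSeriesOnBall_zero a).hasSum
    (y := y) (by simpa [Metric.mem_eball, edist_zero_right, enorm_eq_nnnorm, ← NNReal.coe_lt_coe] using hy)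
  rw [zero_add, one_div, ← Complex.cpow_neg] at h
  refine h.congr_fun fun n => ?_
  have h1 : (n.factorial : ℂ) * Ring.choose (a + n - 1) n = poch a n := by
    have := Ring.factorial_nsmul_multichoose_eq_ascPochhammer a n
    rw [Polynomial.ascPochhammer_smeval_eq_eval, nsmul_eq_mul] at this
    rw [poch, ← this, Ring.choose]
    congr 2
    ring
  have h2 : (n.factorial : ℂ) ≠ 0 := by exact_mod_cast n.factorial_ne_zero
  simp [← h1, mul_div_cancel_left₀ _ h2, mul_comm]

theorem sum_antidiagonal_choose_mul (c : ℕ → ℂ) (j : ℕ) :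
    ∑ p ∈ Finset.HasAntidiagonal.antidiagonal j, (-1) ^ p.1 * c p.1 / ((p.1.factorial : ℂ) * p.2.factorial) =
      (∑ n ∈ Finset.range (j + 1), (-1) ^ n * (j.choose n : ℂ) * c n) / j.factorial := by
  rw [Finset.Nat.sum_antidiagonal_eq_sum_range_succ_mk, Finset.sum_div]
  refine Finset.sum_congr rfl fun n hn => ?_
  have h := Nat.choose_mul_factorial_mul_factorial (Nat.lt_succ_iff.1 (Finset.mem_range.1 hn))
  have h1 : (n.factorial : ℂ) ≠ 0 := by exact_mod_cast n.factorial_ne_zero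
  have h2 : ((j - n).factorial : ℂ) ≠ 0 := by exact_mod_cast (j - n).factorial_ne_zero
  have h3 : (j.factorial : ℂ) ≠ 0 := by exact_mod_cast j.factorial_ne_zero
  have h4 : (j.choose n : ℂ) * n.factorial * (j - n).factorial = j.factorial := by
    exact_mod_cast h
  rw [div_eq_div_iff (mul_ne_zero h1 h2) h3, ← h4]
  ring

theorem sum_antidiagonal_two_pow_div (j : ℕ) :
    ∑ p ∈ Finset.HasAntidiagonal.antidiagonal j, (2 : ℝ) ^ p.1 / ((p.1.factorial : ℝ) * p.2.factorial) =
      3 ^ j / j.factorial := by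
  have h := (Commute.all (2 : ℝ) 1).add_pow j
  rw [show (2 : ℝ) + 1 = 3 by norm_num] at h
  rw [Finset.Nat.sum_antidiagonal_eq_sum_range_succ_mk, h, Finset.sum_div]
  refine Finset.sum_congr rfl fun n hn => ?_
  have h := Nat.choose_mul_factorial_mul_factorial (Nat.lt_succ_iff.1 (Finset.mem_range.1 hn))
  have h4 : (j.choose n : ℝ) * n.factorial * (j - n).factorial = j.factorial := by
    exact_mod_cast h
  rw [div_eq_div_iff (by positivity) (by positivity), ← h4]
  ring

/-- On the diagonal of index j the weights 2ⁱ C(j,i) add up to 3^j, so the majorant is a binomial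
series at 3‖y‖; hence the radius 1/3. -/
theorem summable_euler_transform_double (a : ℂ) {c : ℕ → ℂ} {K : ℝ}
    (hc : ∀ n, ‖c n‖ ≤ K * 2 ^ n) {y : ℂ} (hy : ‖y‖ < 1 / 3) :
    Summable fun p : ℕ × ℕ => poch a (p.1 + p.2) * y ^ (p.1 + p.2) *
      ((-1) ^ p.1 * c p.1 / ((p.1.factorial : ℂ) * p.2.factorial)) := by
  have hK : 0 ≤ K := by simpa using (norm_nonneg _).trans (hc 0)
  set g : ℕ × ℕ → ℝ := fun p => K * (‖poch a (p.1 + p.2)‖ * ‖y‖ ^ (p.1 + p.2)) *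
    ((2 : ℝ) ^ p.1 / ((p.1.factorial : ℝ) * p.2.factorial)) with hg
  have hg0 : ∀ p, 0 ≤ g p := fun p => by positivity
  suffices hs : Summable g by
    refine hs.of_norm_bounded fun p => ?_
    simp only [norm_mul, norm_div, norm_pow, norm_neg, norm_one, one_pow, one_mul,
      Complex.norm_natCast, hg]
    have := hc p.1
    calc _ ≤ ‖poch a (p.1 + p.2)‖ * ‖y‖ ^ (p.1 + p.2) *
          (K * 2 ^ p.1 / ((p.1.factorial : ℝ) * p.2.factorial)) := by gcongr
      _ = _ := by ring
  rw [← (Finset.HasAntidiagonal.sigmaAntidiagonalEquivProd (A := ℕ)).summable_iff,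
    summable_sigma_of_nonneg (f := g ∘ Finset.HasAntidiagonal.sigmaAntidiagonalEquivProd)
      fun p => hg0 _]
  refine ⟨fun j => (hasSum_fintype _).summable, ?_⟩
  have hsum : ∀ j : ℕ, (∑' p : Finset.HasAntidiagonal.antidiagonal j,
      (g ∘ Finset.HasAntidiagonal.sigmaAntidiagonalEquivProd) ⟨j, p⟩) =
      K * (‖poch a j‖ / j.factorial * (3 * ‖y‖) ^ j) := by
    intro j
    rw [tsum_fintype]
    have h1 : ∀ p : Finset.HasAntidiagonal.antidiagonal j, (g ∘ Finset.HasAntidiagonal.sigmaAntidiagonalEquivProd) ⟨j, p⟩ =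
        K * (‖poch a j‖ * ‖y‖ ^ j) *
          ((2 : ℝ) ^ p.1.1 / ((p.1.1.factorial : ℝ) * p.1.2.factorial)) := by
      intro p
      have := Finset.HasAntidiagonal.mem_antidiagonal.1 p.2
      simp [hg, Finset.HasAntidiagonal.sigmaAntidiagonalEquivProd, this]
    rw [Finset.sum_congr rfl fun p _ => h1 p, ← Finset.mul_sum,
      Finset.sum_coe_sort (Finset.HasAntidiagonal.antidiagonal j) fun p : ℕ × ℕ =>
        (2 : ℝ) ^ p.1 / ((p.1.factorial : ℝ) * p.2.factorial),
      sum_antidiagonal_two_pow_div, mul_pow]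
    ring
  simp_rw [hsum]
  refine Summable.mul_left _ ?_
  have hb := (hasSum_binomial (‖a‖ : ℂ) (y := ((3 * ‖y‖ : ℝ) : ℂ)) (by
    rw [Complex.norm_real, Real.norm_of_nonneg (by positivity)]
    linarith)).summable.norm
  refine hb.of_nonneg_of_le (fun j => by positivity) fun j => ?_
  rw [norm_mul, norm_div, norm_pow, Complex.norm_natCast, Complex.norm_real,
    Real.norm_of_nonneg (by positivity : (0 : ℝ) ≤ 3 * ‖y‖)]
  gcongr
  exact norm_poch_le a j

/-- Diagonals of the double series give s. Row n is a binomial series with parameter a+n, because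
(a)_{n+i} = (a)_n (a+n)_i, and 1-y = (1-x)⁻¹ turns it into (1-x)^a times the n-th term in x. -/
theorem hasSum_euler_transform (a : ℂ) {c : ℕ → ℂ} {K : ℝ} (hc : ∀ n, ‖c n‖ ≤ K * 2 ^ n)
    {x : ℂ} (hx1 : x ∈ cutPlane) (hy : ‖x / (x - 1)‖ < 1 / 3) {s : ℂ}
    (hs : HasSum (fun j : ℕ => poch a j * (x / (x - 1)) ^ j *
      ((∑ n ∈ Finset.range (j + 1), (-1) ^ n * (j.choose n : ℂ) * c n) / j.factorial)) s) :
    HasSum (fun n : ℕ => poch a n / n.factorial * c n * x ^ n) ((1 - x) ^ (-a) * s) := by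
  set y := x / (x - 1) with hy_def
  have hx : 1 - x ∈ Complex.slitPlane := by
    rw [cutPlane_eq] at hx1
    rw [Complex.mem_slitPlane_iff]
    rcases hx1 with h | h
    · left; simpa using h
    · right; simpa using h
  have hx0 : 1 - x ≠ 0 := Complex.slitPlane_ne_zero hx
  have hx0' : x - 1 ≠ 0 := by rwa [← neg_ne_zero, neg_sub]
  have hxy : 1 - y = (1 - x)⁻¹ := by
    rw [hy_def]
    field_simp
    ring
  have hsum := summable_euler_transform_double a hc hy
  have htot := hsum.hasSum
  have h1 : ∑' p : ℕ × ℕ, poch a (p.1 + p.2) * y ^ (p.1 + p.2) *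
      ((-1) ^ p.1 * c p.1 / ((p.1.factorial : ℂ) * p.2.factorial)) = s := by
    rw [← (Finset.HasAntidiagonal.sigmaAntidiagonalEquivProd (A := ℕ)).hasSum_iff] at htot
    have hfib := HasSum.sigma htot (g := fun j => ∑ p, _) fun j => hasSum_fintype _
    refine hfib.unique (hs.congr_fun fun j => ?_)
    rw [← sum_antidiagonal_choose_mul, Finset.mul_sum,
      ← Finset.sum_coe_sort (Finset.HasAntidiagonal.antidiagonal j)]
    refine Fintype.sum_congr _ _ fun p => ?_
    have := Finset.HasAntidiagonal.mem_antidiagonal.1 p.2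
    simp [Finset.HasAntidiagonal.sigmaAntidiagonalEquivProd, this]
  rw [h1] at htot
  have hfib : ∀ n : ℕ, HasSum (fun i : ℕ => poch a (n + i) * y ^ (n + i) *
      ((-1) ^ n * c n / ((n.factorial : ℂ) * i.factorial)))
      ((1 - x) ^ a * (poch a n / n.factorial * c n * x ^ n)) := by
    intro n
    have h2 := (hasSum_binomial (a + n) (y := y) (by linarith)).mul_left
      (poch a n * (-1) ^ n * c n / n.factorial * y ^ n)
    have h3 : (1 - y) ^ (-(a + n)) = (1 - x) ^ a * (1 - x) ^ n := by
      rw [hxy, Complex.inv_cpow _ _ (Complex.slitPlane_arg_ne_pi hx), Complex.cpow_neg, inv_inv,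
        Complex.cpow_add _ _ hx0, Complex.cpow_natCast]
    have h4 : (-1) ^ n * y ^ n * (1 - x) ^ n = x ^ n := by
      rw [← mul_pow, ← mul_pow]
      congr 1
      rw [hy_def]
      field_simp
      ring
    rw [h3] at h2
    convert! h2 using 1
    · funext i
      rw [poch_add, pow_add]
      field_simp
    · rw [← h4]
      ring
  have hfin := (htot.prod_fiberwise hfib).mul_left ((1 - x) ^ (-a))
  refine hfin.congr_fun fun n => ?_
  rw [← mul_assoc, ← Complex.cpow_add _ _ hx0, neg_add_cancel, Complex.cpow_zero, one_mul]

theorem summable_norm_mul_pow_div_factorial {c : ℕ → ℂ} {K : ℝ} (hc : ∀ n, ‖c n‖ ≤ K * 2 ^ n)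
    (x : ℂ) : Summable fun n : ℕ => ‖c n / n.factorial * x ^ n‖ := by
  refine ((Real.summable_pow_div_factorial (2 * ‖x‖)).mul_left K).of_nonneg_of_le
    (fun n => norm_nonneg _) fun n => ?_
  rw [norm_mul, norm_div, norm_pow, Complex.norm_natCast]
  have := hc n
  calc _ ≤ K * 2 ^ n / n.factorial * ‖x‖ ^ n := by gcongr
    _ = _ := by rw [mul_pow]; ring

theorem hasSum_exp_transform {c : ℕ → ℂ} {K : ℝ} (hc : ∀ n, ‖c n‖ ≤ K * 2 ^ n) (x : ℂ) :
    HasSum (fun j : ℕ => (-x) ^ j *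
      ((∑ n ∈ Finset.range (j + 1), (-1) ^ n * (j.choose n : ℂ) * c n) / j.factorial))
      (Complex.exp (-x) * ∑' n : ℕ, c n / n.factorial * x ^ n) := by
  have h1 := summable_norm_mul_pow_div_factorial hc x
  have h2 : Summable fun n : ℕ => ‖(-x) ^ n / (n.factorial : ℂ)‖ :=
    NormedSpace.norm_expSeries_div_summable (-x)
  have h3 := (summable_norm_sum_mul_antidiagonal_of_summable_norm h1 h2).of_norm.hasSum
  rw [← tsum_mul_tsum_eq_tsum_sum_antidiagonal_of_summable_norm h1 h2, mul_comm] at h3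
  have h4 : ∑' n : ℕ, (-x) ^ n / (n.factorial : ℂ) = Complex.exp (-x) := by
    rw [Complex.exp_eq_exp_ℂ, NormedSpace.exp_eq_tsum_div]
  rw [h4] at h3
  refine h3.congr_fun fun j => ?_
  rw [← sum_antidiagonal_choose_mul, Finset.mul_sum]
  refine Finset.sum_congr rfl fun p hp => ?_
  rw [← Finset.HasAntidiagonal.mem_antidiagonal.1 hp, pow_add]
  have : (-x) ^ p.1 = (-1) ^ p.1 * x ^ p.1 := by rw [← mul_pow]; simp
  rw [this]
  have h : ((-1 : ℂ) ^ p.1) * (-1) ^ p.1 = 1 := by rw [← mul_pow]; simp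
  linear_combination (x ^ p.1 * (-x) ^ p.2 * c p.1 / (p.1.factorial * p.2.factorial)) * h

/-! ### Parameter integrals and the cut plane -/

open MeasureTheory in
theorem differentiableOn_intervalIntegral_of_continuousOn {U : Set ℂ} (hU : IsOpen U)
    {F F' : ℂ → ℝ → ℂ} {p q : ℝ} (hpq : p ≤ q)
    (hF : ∀ z ∈ U, ContinuousOn (F z) (Set.Icc p q))
    (hF' : ContinuousOn (Function.uncurry F') (U ×ˢ Set.Icc p q))
    (hd : ∀ z ∈ U, ∀ t ∈ Set.Icc p q, HasDerivAt (fun w => F w t) (F' z t) z) :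
    DifferentiableOn ℂ (fun z => ∫ t in p..q, F z t) U := by
  intro z hz
  obtain ⟨ε, hε, hball⟩ := Metric.nhds_basis_closedBall.mem_iff.1 (hU.mem_nhds hz)
  obtain ⟨K, hK⟩ := ((isCompact_closedBall z ε).prod (isCompact_Icc (a := p) (b := q))
    ).exists_bound_of_continuousOn (hF'.mono (Set.prod_mono hball subset_rfl))
  have hsub : Set.uIoc p q ⊆ Set.Icc p q := by
    rw [Set.uIoc_of_le hpq]
    exact Set.Ioc_subset_Icc_self
  have hmeas : ∀ g : ℝ → ℂ, ContinuousOn g (Set.Icc p q) →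
      AEStronglyMeasurable g (volume.restrict (Set.uIoc p q)) := fun g hg =>
    (hg.mono hsub).aestronglyMeasurable measurableSet_uIoc
  have hF'z : ContinuousOn (F' z) (Set.Icc p q) :=
    hF'.comp (Continuous.prodMk_right z).continuousOn fun t ht => ⟨hz, ht⟩
  refine (intervalIntegral.hasDerivAt_integral_of_dominated_loc_of_deriv_le
    (μ := volume) (F := F) (F' := F') (bound := fun _ => K)
    (Metric.closedBall_mem_nhds z hε) ?_ ?_ (hmeas _ hF'z) ?_ intervalIntegrable_const ?_
    ).2.differentiableAt.differentiableWithinAt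
  · filter_upwards [hU.mem_nhds hz] with w hw using hmeas _ (hF w hw)
  · exact (hF z hz).intervalIntegrable_of_Icc hpq
  · exact .of_forall fun t ht w hw => hK (w, t) ⟨hw, hsub ht⟩
  · exact .of_forall fun t ht w hw => hd w (hball hw) t (hsub ht)

theorem isOpen_cutPlane : IsOpen cutPlane := by
  rw [cutPlane_eq]
  exact (isOpen_lt Complex.continuous_re continuous_const).union
    (isOpen_ne_fun Complex.continuous_im continuous_const)

theorem mem_cutPlane_iff {x : ℂ} : x ∈ cutPlane ↔ 1 - x ∈ Complex.slitPlane := by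
  rw [cutPlane_eq, Complex.mem_slitPlane_iff]
  simp

theorem ball_subset_cutPlane : Metric.ball (0 : ℂ) 1 ⊆ cutPlane := by
  intro x hx
  rw [cutPlane_eq]
  left
  exact (Complex.re_le_norm x).trans_lt (by simpa using hx)

theorem one_sub_ofReal_mul_mem_slitPlane {y : ℂ} (hy : y ∈ cutPlane) {t : ℝ}
    (ht : t ∈ Set.Icc (0 : ℝ) 1) : 1 - (t : ℂ) * y ∈ Complex.slitPlane := by
  rw [cutPlane_eq] at hy
  rw [Complex.mem_slitPlane_iff]
  simp only [Complex.sub_re, Complex.one_re, Complex.mul_re, Complex.ofReal_re, Complex.ofReal_im,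
    zero_mul, sub_zero, Complex.sub_im, Complex.one_im, Complex.mul_im, add_zero, zero_sub]
  rcases eq_or_lt_of_le ht.1 with h0 | h0
  · left
    simp [← h0]
  · rcases hy with h | h
    · left
      nlinarith [ht.2]
    · right
      exact neg_ne_zero.2 (mul_ne_zero h0.ne' h)

theorem pFqTerm_one_two (α γ y : ℂ) (n : ℕ) :
    pFqTerm ![1, α] ![γ] y n = poch α n / poch γ n * y ^ n := by
  have h2 : (n.factorial : ℂ) ≠ 0 := by exact_mod_cast n.factorial_ne_zero
  simp only [pFqTerm, Fin.prod_univ_two, Fin.prod_univ_one, Matrix.cons_val_zero,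
    Matrix.cons_val_one, poch_one]
  rw [mul_comm (n.factorial : ℂ), mul_div_mul_right _ _ h2]

theorem poch_eq_prod (z : ℂ) (n : ℕ) : poch z n = ∏ i ∈ Finset.range n, (z + i) := by
  induction n with
  | zero => simp [poch_zero]
  | succ n ih => rw [poch_succ, ih, Finset.prod_range_succ]

/-! ### Continuation of ₂F₁(1, α; γ; y) -/

section EulerIntegral

variable {γ : ℂ}

/-- Asking Re γ > 2 makes the integrand continuous up to t = 1, so no improper integral arises;
smaller Re γ is reached by `IsHypergeometricContinuation.contiguous`. -/
theorem continuousOn_one_sub_cpow (hγ : 2 < γ.re) :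
    ContinuousOn (fun t : ℝ => (1 - (t : ℂ)) ^ (γ - 2)) (Set.Icc 0 1) := by
  intro t ht
  refine ContinuousAt.continuousWithinAt ?_
  rcases eq_or_lt_of_le ht.2 with h | h
  · have h1 : ContinuousAt (fun z : ℂ => z ^ (γ - 2)) (1 - (t : ℂ)) := by
      rw [h]
      simpa using Complex.continuousAt_cpow_const_of_re_pos (z := 0) (w := γ - 2) (by simp)
        (by simpa using hγ)
    exact ContinuousAt.comp (f := fun t : ℝ => 1 - (t : ℂ)) h1 (by fun_prop)
  · refine ContinuousAt.cpow (by fun_prop) (by fun_prop) ?_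
    norm_cast
    exact Complex.ofReal_mem_slitPlane.2 (by linarith)

theorem norm_one_sub_cpow_le (hγ : 2 < γ.re) {t : ℝ} (ht : t ∈ Set.Icc (0 : ℝ) 1) :
    ‖(1 - (t : ℂ)) ^ (γ - 2)‖ ≤ 1 := by
  have h : (1 - (t : ℂ)) = ((1 - t : ℝ) : ℂ) := by push_cast; ring
  have h0 : (γ - 2).re = γ.re - 2 := by simp
  rw [h, Complex.norm_cpow_eq_rpow_re_of_nonneg (by linarith [ht.2]) (by rw [h0]; linarith)]
  exact Real.rpow_le_one (by linarith [ht.2]) (by linarith [ht.1]) (by rw [h0]; linarith)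

theorem integral_one_sub_cpow_mul_pow (hγ : 2 < γ.re) (n : ℕ) :
    ∫ t in (0 : ℝ)..1, (1 - (t : ℂ)) ^ (γ - 2) * (t : ℂ) ^ n =
      n.factorial / ((γ - 1) * poch γ n) := by
  have h := Complex.betaIntegral_eval_nat_add_one_right (u := γ - 1)
    (by simp only [Complex.sub_re, Complex.one_re]; linarith) n
  rw [← Complex.betaIntegral_symm, ← poch_eq_prod, poch_succ_left, sub_add_cancel] at h
  rw [← h, Complex.betaIntegral]
  refine intervalIntegral.integral_congr fun t _ => ?_
  simp only [add_sub_cancel_right, Complex.cpow_natCast]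
  rw [mul_comm]
  congr 2
  ring

/-- Euler's integral for `₂F₁(1, α; γ; y)`, valid for `γ` of large real part. -/
noncomputable def eulerIntegral (α γ y : ℂ) : ℂ :=
  (γ - 1) * ∫ t in (0 : ℝ)..1, (1 - (t : ℂ)) ^ (γ - 2) * (1 - (t : ℂ) * y) ^ (-α)

theorem differentiableOn_eulerIntegral (α : ℂ) (hγ : 2 < γ.re) :
    DifferentiableOn ℂ (eulerIntegral α γ) cutPlane := by
  refine DifferentiableOn.const_mul (differentiableOn_intervalIntegral_of_continuousOn
    (F' := fun y t => (1 - (t : ℂ)) ^ (γ - 2) *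
      (-α * (1 - (t : ℂ) * y) ^ (-α - 1) * (-(t : ℂ)))) isOpen_cutPlane zero_le_one
    (fun y hy => ?_) ?_ fun y hy t ht => ?_) _
  · refine (continuousOn_one_sub_cpow hγ).mul fun t ht => ContinuousAt.continuousWithinAt ?_
    exact ContinuousAt.cpow (by fun_prop) (by fun_prop) (one_sub_ofReal_mul_mem_slitPlane hy ht)
  · refine ContinuousOn.mul ((continuousOn_one_sub_cpow hγ).comp continuousOn_snd
      fun p hp => hp.2) (ContinuousOn.mul (ContinuousOn.mul continuousOn_const ?_) (by fun_prop))
    intro p hp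
    refine ContinuousAt.continuousWithinAt ?_
    exact ContinuousAt.cpow (by fun_prop) (by fun_prop)
      (one_sub_ofReal_mul_mem_slitPlane hp.1 hp.2)
  · have h : HasDerivAt (fun w : ℂ => 1 - (t : ℂ) * w) (-(t : ℂ)) y := by
      simpa using ((hasDerivAt_id y).const_mul (t : ℂ)).const_sub 1
    exact (h.cpow_const (one_sub_ofReal_mul_mem_slitPlane hy ht)).const_mul _

theorem hasSum_eulerIntegral (α : ℂ) (hγ : 2 < γ.re) {y : ℂ} (hy : ‖y‖ < 1) :
    HasSum (pFqTerm ![1, α] ![γ] y) (eulerIntegral α γ y) := by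
  have hIoc : ∀ {t : ℝ}, t ∈ Set.uIoc (0 : ℝ) 1 → t ∈ Set.Icc (0 : ℝ) 1 := fun {t} ht => by
    rw [Set.uIoc_of_le zero_le_one] at ht
    exact Set.Ioc_subset_Icc_self ht
  have hsum := (hasSum_binomial α hy).summable.norm
  have h := intervalIntegral.hasSum_integral_of_dominated_convergence (a := 0) (b := 1)
    (μ := MeasureTheory.volume)
    (F := fun (n : ℕ) (t : ℝ) => (1 - (t : ℂ)) ^ (γ - 2) *
      (poch α n / n.factorial * ((t : ℂ) * y) ^ n))
    (f := fun t : ℝ => (1 - (t : ℂ)) ^ (γ - 2) * (1 - (t : ℂ) * y) ^ (-α))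
    (fun n _ => ‖poch α n / n.factorial * y ^ n‖) (fun n => ?_) (fun n => ?_)
    (.of_forall fun t _ => hsum) intervalIntegrable_const (.of_forall fun t ht => ?_)
  · refine (h.mul_left (γ - 1)).congr_fun fun n => ?_
    have h1 : ∀ t : ℝ, (1 - (t : ℂ)) ^ (γ - 2) * (poch α n / n.factorial * ((t : ℂ) * y) ^ n) =
        (poch α n / n.factorial * y ^ n) * ((1 - (t : ℂ)) ^ (γ - 2) * (t : ℂ) ^ n) := by
      intro t
      rw [mul_pow]
      ring
    have h2 : (n.factorial : ℂ) ≠ 0 := by exact_mod_cast n.factorial_ne_zero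
    have h3 : γ - 1 ≠ 0 := by
      intro h0
      have := congrArg Complex.re h0
      simp only [Complex.sub_re, Complex.one_re, Complex.zero_re] at this
      linarith
    simp_rw [h1]
    rw [intervalIntegral.integral_const_mul, integral_one_sub_cpow_mul_pow hγ, pFqTerm_one_two]
    field_simp
  · refine (ContinuousOn.mono ?_ fun t => hIoc).aestronglyMeasurable measurableSet_uIoc
    exact (continuousOn_one_sub_cpow hγ).mul (by fun_prop)
  · refine .of_forall fun t ht => ?_
    have ht' := hIoc ht
    rw [norm_mul, norm_mul, norm_mul, norm_pow, norm_pow, norm_mul, Complex.norm_real,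
      Real.norm_of_nonneg ht'.1]
    calc _ ≤ 1 * (‖poch α n / n.factorial‖ * (1 * ‖y‖) ^ n) := by
          have h1 := norm_one_sub_cpow_le hγ ht'
          have h2 := ht'.1
          have h3 := ht'.2
          gcongr
      _ = _ := by ring
  · have ht' := hIoc ht
    refine (hasSum_binomial α ?_).mul_left _
    rw [norm_mul, Complex.norm_real, Real.norm_of_nonneg ht'.1]
    nlinarith [ht'.2, norm_nonneg y]

end EulerIntegral

/-- Term n+1 of the lower series is αy/γ times term n of the upper one. This includes γ = 0, where
both are 0 by division by zero. -/
theorem IsHypergeometricContinuation.contiguous {α γ : ℂ} {F : ℂ → ℂ}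
    (h : IsHypergeometricContinuation ![1, α + 1] ![γ + 1] F) :
    IsHypergeometricContinuation ![1, α] ![γ] fun y => α / γ * y * F y + 1 := by
  refine ⟨((differentiableOn_id.const_mul _).mul h.1).add_const 1, fun y hy => ?_⟩
  rw [← hasSum_nat_add_iff' 1]
  simp only [Finset.range_one, Finset.sum_singleton, pFqTerm_one_two, poch_zero, pow_zero,
    div_one, mul_one, add_sub_cancel_right]
  refine ((h.2 y hy).mul_left (α / γ * y)).congr_fun fun n => ?_
  rw [pFqTerm_one_two, poch_succ_left, poch_succ_left, mul_div_mul_comm]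
  ring

theorem exists_isHypergeometricContinuation_one (α γ : ℂ) :
    ∃ F, IsHypergeometricContinuation ![1, α] ![γ] F := by
  obtain ⟨N, hN⟩ := exists_nat_gt (2 - γ.re)
  induction N generalizing α γ with
  | zero =>
    have hγ : 2 < γ.re := by
      rw [Nat.cast_zero] at hN
      linarith
    exact ⟨_, differentiableOn_eulerIntegral α hγ,
      fun y hy => hasSum_eulerIntegral α hγ (by simpa using hy)⟩
  | succ N ih =>
    obtain ⟨F, hF⟩ := ih (α + 1) (γ + 1) (by
      push_cast at hN
      rw [Complex.add_re, Complex.one_re]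
      linarith)
    exact ⟨_, hF.contiguous⟩

/-! ### Recognizing a continuation; growth estimates -/

section

open Filter Topology

/-- The germ at 0 determines the Taylor coefficients, and holomorphy on discs of every radius below
1 makes the Taylor series converge there. -/
theorem isHypergeometricContinuation_of_eventually {p q : ℕ} {a : Fin p → ℂ} {b : Fin q → ℂ}
    {H : ℂ → ℂ} (hd : DifferentiableOn ℂ H cutPlane)
    (h0 : ∀ᶠ x in 𝓝 (0 : ℂ), HasSum (pFqTerm a b x) (H x)) :
    IsHypergeometricContinuation a b H := by
  refine ⟨hd, fun x hx => ?_⟩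
  set φ : FormalMultilinearSeries ℂ ℂ ℂ := .ofScalars ℂ fun n => pFqTerm a b 1 n with hφ
  have hφ0 : HasFPowerSeriesAt H φ 0 := by
    rw [hasFPowerSeriesAt_iff]
    filter_upwards [h0] with z hz
    rw [zero_add]
    refine hz.congr_fun fun n => ?_
    simp [hφ, FormalMultilinearSeries.coeff_ofScalars, pFqTerm, mul_comm]
  obtain ⟨R, hxR, hR⟩ := exists_between (show ‖x‖ < 1 by simpa using hx)
  lift R to NNReal using (norm_nonneg x).trans hxR.le
  have hR0 : 0 < R := by exact_mod_cast (norm_nonneg x).trans_lt hxR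
  have hsub : Metric.closedBall (0 : ℂ) R ⊆ cutPlane :=
    (Metric.closedBall_subset_ball hR).trans ball_subset_cutPlane
  have hball := (hd.mono hsub).hasFPowerSeriesOnBall hR0
  rw [hball.hasFPowerSeriesAt.eq_formalMultilinearSeries hφ0] at hball
  have hs := hball.hasSum (y := x) (by
    rw [Metric.mem_eball, edist_zero_right, enorm_eq_nnnorm]
    exact_mod_cast hxR)
  rw [zero_add] at hs
  refine hs.congr_fun fun n => ?_
  simp [hφ, pFqTerm, mul_comm]

theorem isHypergeometricContinuation_pFqCut {p q : ℕ} {a : Fin p → ℂ} {b : Fin q → ℂ}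
    (h : ∃ F, IsHypergeometricContinuation a b F) :
    IsHypergeometricContinuation a b (pFqCut a b) := by
  rw [pFqCut, dif_pos h]
  exact h.choose_spec

theorem div_sub_one_mem_cutPlane {x : ℂ} (hx : x ∈ cutPlane) : x / (x - 1) ∈ cutPlane := by
  rw [mem_cutPlane_iff] at hx ⊢
  have h0 : 1 - x ≠ 0 := Complex.slitPlane_ne_zero hx
  have h0' : x - 1 ≠ 0 := by rwa [← neg_ne_zero, neg_sub]
  have h1 : 1 - x / (x - 1) = (1 - x)⁻¹ := by
    field_simp
    ring
  rw [h1, Complex.mem_slitPlane_iff_arg]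
  exact ⟨by
    rw [Complex.arg_inv, if_neg (Complex.slitPlane_arg_ne_pi hx)]
    intro h
    linarith [Complex.neg_pi_lt_arg (1 - x)], inv_ne_zero h0⟩

theorem exists_norm_poch_div_poch_add_one_le {b : ℂ} (hb : ∀ n : ℕ, b + 1 ≠ -(n : ℂ)) :
    ∃ K : ℝ, ∀ n : ℕ, ‖poch b n / poch (b + 1) n‖ ≤ K := by
  -- The quotient is b/(b+n); it is kept multiplied out because b + n may vanish at n = 0.
  have hlim : Tendsto (fun n : ℕ => ‖poch b n / poch (b + 1) n‖ * ‖b + n‖) atTop (𝓝 ‖b‖) := by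
    refine tendsto_const_nhds.congr fun n => ?_
    have hp : poch (b + 1) n ≠ 0 := poch_ne_zero fun i _ => hb i
    rw [← norm_mul, div_mul_eq_mul_div, poch_mul_add, mul_div_cancel_right₀ _ hp]
  have hinv : Tendsto (fun n : ℕ => ‖b + n‖⁻¹) atTop (𝓝 0) := by
    refine tendsto_inv_atTop_zero.comp (tendsto_norm_cobounded_atTop.comp ?_)
    exact (tendsto_const_add_cobounded b).comp tendsto_natCast_atTop_cobounded
  have hprod := hlim.mul hinv
  have heq : Tendsto (fun n : ℕ => ‖poch b n / poch (b + 1) n‖) atTop (𝓝 (‖b‖ * 0)) := by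
    refine hprod.congr' ?_
    filter_upwards [eventually_gt_atTop 0] with n hn
    obtain ⟨k, rfl⟩ : ∃ k, n = k + 1 := ⟨n - 1, by omega⟩
    have h : b + (k + 1 : ℕ) ≠ 0 := by
      intro h
      apply hb k
      push_cast at h
      linear_combination h
    rw [mul_inv_cancel_right₀ (norm_ne_zero_iff.2 h)]
  obtain ⟨K, hK⟩ := heq.bddAbove_range
  exact ⟨K, fun n => hK ⟨n, rfl⟩⟩

theorem summable_pow_div_poch (γ x : ℂ) : Summable fun n : ℕ => x ^ n / poch γ n := by
  refine summable_of_ratio_norm_eventually_le (r := 1 / 2) (by norm_num) ?_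
  have hlim : Tendsto (fun n : ℕ => ‖γ + n‖) atTop atTop :=
    tendsto_norm_cobounded_atTop.comp
      ((tendsto_const_add_cobounded γ).comp tendsto_natCast_atTop_cobounded)
  filter_upwards [hlim.eventually_ge_atTop (2 * ‖x‖), hlim.eventually_gt_atTop 0] with n hn hn0
  rw [poch_succ, pow_succ, mul_div_mul_comm, norm_mul, mul_comm, norm_div x]
  refine mul_le_mul_of_nonneg_right ?_ (norm_nonneg _)
  rw [div_le_iff₀ hn0]
  linarith

/-! ### The transformed series -/

section

variable {r : ℕ} (f : Fin r → ℂ) (m : Fin r → ℕ) (b : ℂ)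

/-- The coefficients `(b)_n (f + m)_n / ((b + 1)_n (f)_n)`. -/
noncomputable def shiftedCoeff (n : ℕ) : ℂ := poch b n / poch (b + 1) n * stirlingPoly f m n

variable {f b}

theorem exists_norm_shiftedCoeff_le (hb : ∀ n : ℕ, b + 1 ≠ -(n : ℂ)) :
    ∃ K : ℝ, ∀ n : ℕ, ‖shiftedCoeff f m b n‖ ≤ K * 2 ^ n := by
  obtain ⟨K₁, h₁⟩ := exists_norm_poch_div_poch_add_one_le hb
  obtain ⟨K₂, h₂⟩ := exists_norm_stirlingPoly_le f m
  refine ⟨K₁ * K₂, fun n => ?_⟩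
  rw [shiftedCoeff, norm_mul, mul_assoc]
  exact mul_le_mul (h₁ n) (h₂ n) (norm_nonneg _) ((norm_nonneg _).trans (h₁ n))

theorem sum_choose_mul_shiftedCoeff_div (hb : ∀ n : ℕ, b + 1 ≠ -(n : ℂ)) (j : ℕ) :
    (∑ n ∈ Finset.range (j + 1), (-1) ^ n * (j.choose n : ℂ) * shiftedCoeff f m b n) /
        j.factorial =
      1 / poch (b + 1) j * ∑ k ∈ Finset.range (j + 1), (-1) ^ k * poch b k * Ccoeff f m k := by
  have h : (j.factorial : ℂ) ≠ 0 := by exact_mod_cast j.factorial_ne_zero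
  simp only [shiftedCoeff]
  rw [sum_choose_mul_stirlingPoly f m hb]
  field_simp

theorem pFqTerm_shifted (hf : ∀ j, ∀ n : ℕ, f j ≠ -(n : ℂ)) (a x : ℂ) (n : ℕ) :
    pFqTerm (Matrix.vecCons a (Matrix.vecCons b (fun j => f j + (m j : ℂ))))
      (Matrix.vecCons (b + 1) f) x n =
      poch a n / n.factorial * shiftedCoeff f m b n * x ^ n := by
  rw [shiftedCoeff, ← prod_poch_shift_div f m hf, pFqTerm]
  simp only [Fin.prod_univ_succ, Matrix.cons_val_zero, Matrix.cons_val_succ]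
  ring

theorem pFqTerm_shifted_confluent (hf : ∀ j, ∀ n : ℕ, f j ≠ -(n : ℂ)) (x : ℂ) (n : ℕ) :
    pFqTerm (Matrix.vecCons b (fun j => f j + (m j : ℂ))) (Matrix.vecCons (b + 1) f) x n =
      shiftedCoeff f m b n / n.factorial * x ^ n := by
  rw [shiftedCoeff, ← prod_poch_shift_div f m hf, pFqTerm]
  simp only [Fin.prod_univ_succ, Matrix.cons_val_zero, Matrix.cons_val_succ]
  ring

variable (f b)

/-- The transformed function `(1 - x)^a F(x)`, as a function of `y = x / (x - 1)`; here `G` is the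
Gauss function of the remainder term. -/
noncomputable def transformedSum (a : ℂ) (G : ℂ → ℂ) (y : ℂ) : ℂ :=
  ∑ j ∈ Finset.range (∑ j, m j), poch a j / poch (b + 1) j * y ^ j *
      ∑ k ∈ Finset.range (j + 1), (-1) ^ k * poch b k * Ccoeff f m k +
    poch a (∑ j, m j) * vecPoch (fun j => f j - b) m /
      (poch (b + 1) (∑ j, m j) * vecPoch f m) * y ^ (∑ j, m j) * G y

variable {f b}

theorem hasSum_transformedSum (hf : ∀ j, ∀ n : ℕ, f j ≠ -(n : ℂ))
    (hb : ∀ n : ℕ, b + 1 ≠ -(n : ℂ)) (a : ℂ) {G : ℂ → ℂ}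
    (hG : IsHypergeometricContinuation ![1, a + (∑ j, m j : ℕ)] ![b + (∑ j, m j : ℕ) + 1] G)
    {y : ℂ} (hy : ‖y‖ < 1) :
    HasSum (fun j : ℕ => poch a j * y ^ j * ((∑ n ∈ Finset.range (j + 1),
      (-1) ^ n * (j.choose n : ℂ) * shiftedCoeff f m b n) / j.factorial))
      (transformedSum f m b a G y) := by
  simp_rw [sum_choose_mul_shiftedCoeff_div m hb]
  rw [← hasSum_nat_add_iff' (∑ j, m j), transformedSum]
  have h1 : ∀ j ∈ Finset.range (∑ j, m j), poch a j / poch (b + 1) j * y ^ j *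
      ∑ k ∈ Finset.range (j + 1), (-1) ^ k * poch b k * Ccoeff f m k =
      poch a j * y ^ j * (1 / poch (b + 1) j * ∑ k ∈ Finset.range (j + 1),
        (-1) ^ k * poch b k * Ccoeff f m k) := fun j _ => by ring
  rw [Finset.sum_congr rfl h1, add_sub_cancel_left]
  refine ((hG.2 y (by simpa using hy)).mul_left _).congr_fun fun n => ?_
  rw [sum_neg_one_pow_mul_Ccoeff f m b (Nat.le_add_left _ n) (vecPoch_ne_zero hf m),
    pFqTerm_one_two, add_comm n, poch_add a, poch_add (b + 1), pow_add, add_right_comm b 1]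
  ring

theorem hasSum_confluent_transform (hf : ∀ j, ∀ n : ℕ, f j ≠ -(n : ℂ))
    (hb : ∀ n : ℕ, b + 1 ≠ -(n : ℂ)) (z : ℂ) :
    HasSum (fun j : ℕ => z ^ j * ((∑ n ∈ Finset.range (j + 1),
      (-1) ^ n * (j.choose n : ℂ) * shiftedCoeff f m b n) / j.factorial))
      (∑ j ∈ Finset.range (∑ j, m j), z ^ j / poch (b + 1) j *
          ∑ k ∈ Finset.range (j + 1), (-1) ^ k * poch b k * Ccoeff f m k +
        z ^ (∑ j, m j) * vecPoch (fun j => f j - b) m /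
          (poch (b + 1) (∑ j, m j) * vecPoch f m) *
          ∑' n : ℕ, z ^ n / poch (b + (∑ j, m j : ℕ) + 1) n) := by
  simp_rw [sum_choose_mul_shiftedCoeff_div m hb]
  rw [← hasSum_nat_add_iff' (∑ j, m j)]
  have h1 : ∀ j ∈ Finset.range (∑ j, m j), z ^ j / poch (b + 1) j *
      ∑ k ∈ Finset.range (j + 1), (-1) ^ k * poch b k * Ccoeff f m k =
      z ^ j * (1 / poch (b + 1) j * ∑ k ∈ Finset.range (j + 1),
        (-1) ^ k * poch b k * Ccoeff f m k) := fun j _ => by ring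
  rw [Finset.sum_congr rfl h1, add_sub_cancel_left]
  refine ((summable_pow_div_poch _ z).hasSum.mul_left _).congr_fun fun n => ?_
  rw [sum_neg_one_pow_mul_Ccoeff f m b (Nat.le_add_left _ n) (vecPoch_ne_zero hf m),
    add_comm n, poch_add (b + 1), pow_add, add_right_comm b 1]
  ring

/-- x ↦ x/(x-1) maps the cut plane into itself, so the closed form is holomorphic there; it need
only match the series where |x/(x-1)| < 1/3. -/
theorem isHypergeometricContinuation_transformedSum (hf : ∀ j, ∀ n : ℕ, f j ≠ -(n : ℂ))
    (hb : ∀ n : ℕ, b + 1 ≠ -(n : ℂ)) (a : ℂ) {G : ℂ → ℂ}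
    (hG : IsHypergeometricContinuation ![1, a + (∑ j, m j : ℕ)] ![b + (∑ j, m j : ℕ) + 1] G) :
    IsHypergeometricContinuation
      (Matrix.vecCons a (Matrix.vecCons b (fun j => f j + (m j : ℂ)))) (Matrix.vecCons (b + 1) f)
      fun x => (1 - x) ^ (-a) * transformedSum f m b a G (x / (x - 1)) := by
  refine isHypergeometricContinuation_of_eventually ?_ ?_
  · refine DifferentiableOn.mul (fun x hx => ?_) ?_
    · refine DifferentiableAt.differentiableWithinAt ?_
      exact DifferentiableAt.cpow (by fun_prop) (by fun_prop) (mem_cutPlane_iff.1 hx)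
    · have hT : DifferentiableOn ℂ (transformedSum f m b a G) cutPlane := by
        refine DifferentiableOn.add (by fun_prop) (DifferentiableOn.mul (by fun_prop) hG.1)
      refine hT.comp (fun x hx => ?_) fun x hx => div_sub_one_mem_cutPlane hx
      refine DifferentiableAt.differentiableWithinAt ?_
      have h0 : x - 1 ≠ 0 := by
        rw [← neg_ne_zero, neg_sub]
        exact Complex.slitPlane_ne_zero (mem_cutPlane_iff.1 hx)
      fun_prop (disch := exact h0)
  · obtain ⟨K, hK⟩ := exists_norm_shiftedCoeff_le (f := f) m hb
    have hcont : ContinuousAt (fun x : ℂ => ‖x / (x - 1)‖) 0 := by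
      have : (0 : ℂ) - 1 ≠ 0 := by norm_num
      fun_prop (disch := exact this)
    have hsmall := hcont.eventually_lt_const (show ‖(0 : ℂ) / (0 - 1)‖ < 1 / 3 by norm_num)
    filter_upwards [hsmall, Metric.ball_mem_nhds (0 : ℂ) one_pos] with x hx hx1
    refine (hasSum_euler_transform a hK (ball_subset_cutPlane hx1) hx
      (hasSum_transformedSum m hf hb a hG (by linarith))).congr_fun fun n => ?_
    rw [pFqTerm_shifted m hf]

end

end

theorem corollary3 (r : ℕ) (hr : 1 ≤ r) (m : Fin r → ℕ) (hm : ∀ j, 1 ≤ m j)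
    (f : Fin r → ℂ) (hf : ∀ j, ∀ n : ℕ, f j ≠ -(n : ℂ))
    (a b : ℂ) (hb : ∀ n : ℕ, b + 1 ≠ -(n : ℂ))
    (hfb : ∀ j, ∀ i : ℕ, i < m j → f j - b ≠ -(i : ℂ))
    (M : ℕ) (hM : M = ∑ j, m j) :
    -- the hypergeometric functions of the first identity are well defined on `ℂ \ [1, ∞)`
    (IsHypergeometricContinuation
        (Matrix.vecCons a (Matrix.vecCons b (fun j => f j + (m j : ℂ))))
        (Matrix.vecCons (b + 1) f)
        (pFqCut (Matrix.vecCons a (Matrix.vecCons b (fun j => f j + (m j : ℂ))))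
          (Matrix.vecCons (b + 1) f)) ∧
      IsHypergeometricContinuation ![1, a + M] ![b + M + 1]
        (pFqCut ![1, a + M] ![b + M + 1]) ∧
      -- the first identity
      ∀ x ∈ cutPlane,
        x / (x - 1) ∈ cutPlane ∧
        (1 - x) ^ a *
            pFqCut (Matrix.vecCons a (Matrix.vecCons b (fun j => f j + (m j : ℂ))))
              (Matrix.vecCons (b + 1) f) x =
          ∑ j ∈ Finset.range M, poch a j / poch (b + 1) j * (x / (x - 1)) ^ j *
              ∑ k ∈ Finset.range (j + 1), (-1) ^ k * poch b k * Ccoeff f m k +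
            x ^ M * poch a M * vecPoch (fun j => f j - b) m /
                ((x - 1) ^ M * poch (b + 1) M * vecPoch f m) *
              pFqCut ![1, a + M] ![b + M + 1] (x / (x - 1))) ∧
    -- the confluent identity, whose series converge everywhere
    (∀ x : ℂ,
      Summable (pFqTerm (Matrix.vecCons b (fun j => f j + (m j : ℂ)))
          (Matrix.vecCons (b + 1) f) x) ∧
      Summable (pFqTerm ![1] ![b + M + 1] (-x)) ∧
      Complex.exp (-x) *
          pFqSeries (Matrix.vecCons b (fun j => f j + (m j : ℂ)))
            (Matrix.vecCons (b + 1) f) x =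
        ∑ j ∈ Finset.range M, (-x) ^ j / poch (b + 1) j *
            ∑ k ∈ Finset.range (j + 1), (-1) ^ k * poch b k * Ccoeff f m k +
          (-x) ^ M * vecPoch (fun j => f j - b) m / (poch (b + 1) M * vecPoch f m) *
            pFqSeries ![1] ![b + M + 1] (-x)) := by
  subst hM
  have hG := isHypergeometricContinuation_pFqCut (exists_isHypergeometricContinuation_one
    (a + (∑ j, m j : ℕ)) (b + (∑ j, m j : ℕ) + 1))
  have hH := isHypergeometricContinuation_transformedSum m hf hb a hG
  have hF := isHypergeometricContinuation_pFqCut ⟨_, hH⟩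
  refine ⟨⟨hF, hG, fun x hx => ⟨div_sub_one_mem_cutPlane hx, ?_⟩⟩, fun x => ?_⟩
  · have hx0 : 1 - x ≠ 0 := Complex.slitPlane_ne_zero (mem_cutPlane_iff.1 hx)
    rw [hF.eqOn hH hx, ← mul_assoc, ← Complex.cpow_add _ _ hx0, add_neg_cancel,
      Complex.cpow_zero, one_mul, transformedSum, div_pow x (x - 1) (∑ j, m j)]
    ring
  · obtain ⟨K, hK⟩ := exists_norm_shiftedCoeff_le (f := f) m hb
    have hterm : ∀ n : ℕ, pFqTerm ![1] ![b + (∑ j, m j : ℕ) + 1] (-x) n =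
        (-x) ^ n / poch (b + (∑ j, m j : ℕ) + 1) n := by
      intro n
      have h : (n.factorial : ℂ) ≠ 0 := by exact_mod_cast n.factorial_ne_zero
      simp only [pFqTerm, Fin.prod_univ_one, Matrix.cons_val_zero, poch_one]
      field_simp
    have hterm' := funext (pFqTerm_shifted_confluent (b := b) m hf x)
    refine ⟨?_, ?_, ?_⟩
    · rw [hterm']
      exact (summable_norm_mul_pow_div_factorial hK x).of_norm
    · rw [funext hterm]
      exact summable_pow_div_poch _ _
    · rw [pFqSeries, pFqSeries, hterm', funext hterm]
      -- Both sides are sums of the same series in powers of -x.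
      exact (hasSum_exp_transform hK x).unique (hasSum_confluent_transform m hf hb (-x))
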